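/- Let $d\ge 3$. Consider a structure with a set $B$ of bodies, subsets $\mathrm{IOb},\mathrm{Ph}\subseteq B$ (inertial observers and light signals), a set $Q$ of quantities with operations $+,\cdot$ and a relation $\le$, and a worldview relation $W\subseteq B\times B\times Q^d$, where $W(m,b,\bar x)$ reads "$m$ coordinatizes $b$ at $\bar x=\langle x_1,\dots,x_d\rangle$". Write $\mathrm{ev}_m(\bar x)=\{b: W(m,b,\bar x)\}$, $\mathrm{time}(\bar x,\bar y)=x_1-y_1$ and $\mathrm{space}^2(\bar x,\bar y)=\sum_{i=2}^d (x_i-y_i)^2$. Assume: - AxOField: $\langle Q,+,\cdot,\le\rangle$ is an ordered field; - AxEv: for all $m,k\in\mathrm{IOb}$ and all $\bar x\in Q^d$ there is $\bar y\in Q^d$ with $\mathrm{ev}_m(\bar x)=\mathrm{ev}_k(\bar y)$; - AxPh: for every $m\in\mathrm{IOb}$ there is $c>0$ in $Q$ such that for all $\bar x,\bar y\in Q^d$: some $p\in\mathrm{Ph}$ satisfies $W(m,p,\bar x)$ and $W(m,p,\bar y)$ if and only if $\mathrm{space}^2(\bar x,\bar y)=c^2\,\mathrm{time}(\bar x,\bar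 y)^2$. For $m\in\mathrm{IOb}$ let $\mathsf c_m$ be the speed of light according to $m$, that is, the (by AxPh unique) $v>0$ in $Q$ such that $\mathrm{space}^2(\bar x,\bar y)=v^2\,\mathrm{time}(\bar x,\bar y)^2$ whenever some $p\in\mathrm{Ph}$ satisfies $W(m,p,\bar x)$ and $W(m,p,\bar y)$. For $m,k\in\mathrm{IOb}$ let the worldview transformation $\mathsf w_{mk}$ be the binary relation on $Q^d$ given by $\mathsf w_{mk}(\bar x,\bar y)\iff \mathrm{ev}_m(\bar x)=\mathrm{ev}_k(\bar y)\neq\emptyset$. For $c>0$ let $S_c(\bar x)=\langle x_1,cx_2,\dots,cx_d\rangle$ and $T_c(\bar x)=\langle cx_1,x_2,\dots,x_d\rangle$. For an automorphism $\alpha$ of the field $\langle Q,+,\cdot\rangle$ (not necessarily order preserving) let $\tilde\alpha(\bar x)=\langle\alpha(x_1),\dots,\alpha(x_d)\rangle$. An almost Lorentz transformation is a linear bijection $A$ of $Q^d$ for which there is $\lambda\ne 0$ in $Q$ with $\mu(A(\bar x))=\lambda\,\mu(\bar x)$ for all $\bar x\in Q^d$, where $\mu(\bar x)=x_1^2-x_2^2-\dots-x_d^2$.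 Functions are regarded as binary relations, and $R\mathbin{;}S=\{\langle a,c\rangle:\exists b\ (R(a,b)\wedge S(b,c))\}$ (so the leftmost map is applied first). Then for all $m,k\in\mathrm{IOb}$: - there are an almost Lorentz transformation $A$, a field automorphism $\alpha$ of $Q$ and a translation $T$ of $Q^d$ with $$\mathsf w_{mk}=S_{\mathsf c_m}^{-1}\mathbin{;}A\mathbin{;}\tilde\alpha\mathbin{;}T\mathbin{;}S_{\mathsf c_k};$$ - there are an almost Lorentz transformation $A$, a field automorphism $\alpha$ of $Q$ and a translation $T$ of $Q^d$ with $$\mathsf w_{mk}=T_{\mathsf c_m}\mathbin{;}A\mathbin{;}\tilde\alpha\mathbin{;}T\mathbin{;}T_{\mathsf c_k}^{-1}.$$ -/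

import Mathlib

open scoped SetRel

/-- Models of the two-sorted language of `d`-dimensional spacetimes: `B` is the sort of bodies,
`Q` the sort of quantities, and `W m b x` says that `m` coordinatizes `b` at the coordinate
point `x`. The coordinate with index `0` is time, the remaining ones are spatial. -/
structure SpacetimeModel (d : ℕ) (B Q : Type*) where
  /-- the observers -/
  Ob : Set B
  /-- the inertial observers -/
  IOb : Set B
  /-- the light signals -/
  Ph : Set B
  /-- the worldview relation -/
  W : B → B → (Fin d → Q) → Prop

namespace SpacetimeModel

section Coordinates

variable {d : ℕ} [NeZero d] {Q : Type*} [Field Q]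

/-- Time difference of two coordinate points. -/
def time (x y : Fin d → Q) : Q := x 0 - y 0

/-- Squared spatial distance of two coordinate points. -/
def space2 (x y : Fin d → Q) : Q := ∑ i ∈ Finset.univ.erase (0 : Fin d), (x i - y i) ^ 2

/-- The `c`-Minkowski quadratic form `c x₁² - x₂² - ⋯ - x_d²`. -/
def minkowski (c : Q) (x : Fin d → Q) : Q :=
  c * x 0 ^ 2 - ∑ i ∈ Finset.univ.erase (0 : Fin d), x i ^ 2

/-- Almost Lorentz transformations: linear bijections multiplying the `1`-Minkowski form by a
nonzero constant. -/
def IsAlmostLorentz (A : (Fin d → Q) ≃ₗ[Q] (Fin d → Q)) : Prop :=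
  ∃ l : Q, l ≠ 0 ∧ ∀ x, minkowski 1 (A x) = l * minkowski 1 x

/-- Rescaling of the spatial coordinates, `⟨x₁, c x₂, …, c x_d⟩`. -/
def spaceRescale (c : Q) (x : Fin d → Q) : Fin d → Q := fun i => if i = 0 then x i else c * x i

/-- Rescaling of the time coordinate, `⟨c x₁, x₂, …, x_d⟩`. -/
def timeRescale (c : Q) (x : Fin d → Q) : Fin d → Q := fun i => if i = 0 then c * x i else x i

end Coordinates

/-- The map induced by a field automorphism, acting on each coordinate (the automorphism need not
preserve the order). -/
def autInduced {d : ℕ} {Q : Type*} [Field Q] (α : Q ≃+* Q) (x : Fin d → Q) : Fin d → Q :=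
  fun i => α (x i)

/-- Translation by the vector `b`. -/
def translation {d : ℕ} {Q : Type*} [Field Q] (b x : Fin d → Q) : Fin d → Q := x + b

section Model

variable {d : ℕ} {B Q : Type*} (M : SpacetimeModel d B Q)

/-- The event occurring for `m` at `x`: the set of bodies that `m` coordinatizes at `x`. -/
def ev (m : B) (x : Fin d → Q) : Set B := {b | M.W m b x}

/-- The worldview transformation between `m` and `k`: the binary relation connecting the
coordinate points at which `m` and `k` coordinatize the same nonempty event. -/
def worldview (m k : B) : SetRel (Fin d → Q) (Fin d → Q) :=
  {p | M.ev m p.1 = M.ev k p.2 ∧ (M.ev m p.1).Nonempty}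

/-- All inertial observers coordinatize the same set of events. -/
def AxEv : Prop :=
  ∀ m ∈ M.IOb, ∀ k ∈ M.IOb, ∀ x : Fin d → Q, ∃ y : Fin d → Q, M.ev m x = M.ev k y

variable [NeZero d] [Field Q] [LinearOrder Q]

/-- For every inertial observer there is a positive quantity `c` such that two coordinate points
can be connected by a light signal exactly if they lie on a line of speed `c`. -/
def AxPh : Prop :=
  ∀ m ∈ M.IOb, ∃ c : Q, 0 < c ∧ ∀ x y : Fin d → Q,
    (∃ p ∈ M.Ph, M.W m p x ∧ M.W m p y) ↔ space2 x y = c ^ 2 * time x y ^ 2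

/-- `v` is the speed of light according to `m`. -/
def IsLightSpeed (m : B) (v : Q) : Prop :=
  0 < v ∧ ∀ x y : Fin d → Q,
    (∃ p ∈ M.Ph, M.W m p x ∧ M.W m p y) → space2 x y = v ^ 2 * time x y ^ 2

/-- Under the light axiom every inertial observer has exactly one speed of light, so that it may be
denoted by `c_m`. -/
theorem existsUnique_isLightSpeed [IsStrictOrderedRing Q] (hd : 2 ≤ d) (hPh : M.AxPh)
    {m : B} (hm : m ∈ M.IOb) : ∃! v : Q, M.IsLightSpeed m v := by
  obtain ⟨c, hc, h⟩ := hPh m hm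
  refine ⟨c, ⟨hc, fun x y => (h x y).1⟩, ?_⟩
  rintro v ⟨hv, hv2⟩
  have h1 : (⟨1, hd⟩ : Fin d) ∈ Finset.univ.erase (0 : Fin d) := by
    simp [Fin.ext_iff]
  let x : Fin d → Q := fun i => if i = 0 then 1 else if i = ⟨1, hd⟩ then c else 0
  have hs : space2 x 0 = c ^ 2 := by
    unfold space2
    rw [Finset.sum_eq_single_of_mem _ h1]
    · have : (⟨1, hd⟩ : Fin d) ≠ 0 := by simp [Fin.ext_iff]
      simp [x, this]
    · intro i hi hi1
      have : i ≠ 0 := by simpa using hi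
      simp [x, this, hi1]
  have ht : time x 0 = 1 := by simp [time, x]
  have := hv2 x 0 ((h x 0).2 (by rw [hs, ht]; ring))
  rw [hs, ht] at this
  have h3 : c ^ 2 = v ^ 2 := by simpa using this
  exact ((pow_left_inj₀ hc.le hv.le two_ne_zero).1 h3).symm

end Model

end SpacetimeModel

namespace SpacetimeModel

/-! ### The Lorentz form and its null vectors -/

section NullGeometry

variable {d : ℕ} [NeZero d] {Q : Type*} [Field Q]

/-! Photons belong to events, so a worldview transformation preserves connectibility by light. It is
a bijection because a point is determined by the points light-connected to it (`ev_injective`).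
After rescaling by the speeds of light it preserves the null relation of a single form in both
directions, and `PreservesNull.exists_decomposition`, an Alexandrov–Zeeman theorem over an ordered
field, applies. Since square roots may be missing, only explicit light vectors such as `e₀ ± eᵢ` are
used.

The null hyperplane tangent to a null line is definable from connectibility alone
(`lorentzForm_eq_zero_iff_connectible`), so a null bijection `g` respects null lines, their tangent
hyperplanes and parallelism. Parallelograms spanned by non-orthogonal null vectors are therefore
preserved, and for `d ≥ 3` enough of them exist to make `g - g 0` additive
(`PreservesNull.map_add`). On each null line it then acts through an additive multiplier. The conic
of null combinations of three null vectors forces the multipliers to agree and be multiplicative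
(`eq_and_map_mul_of_conic`), so the map is semilinear. Removing the field automorphism leaves a
linear map preserving the null cone, which must rescale the form (`isAlmostLorentz_of_null`). -/

/-- The symmetric bilinear form associated with the `1`-Minkowski quadratic form. -/
def lorentzForm (d : ℕ) [NeZero d] (Q : Type*) [Field Q] : LinearMap.BilinForm Q (Fin d → Q) :=
  LinearMap.mk₂ Q (fun x y => x 0 * y 0 - ∑ i ∈ Finset.univ.erase (0 : Fin d), x i * y i)
    (fun x y z => by simp only [Pi.add_apply, add_mul, Finset.sum_add_distrib]; ring)
    (fun c x y => by
      simp only [Pi.smul_apply, smul_eq_mul, mul_sub, Finset.mul_sum, mul_assoc])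
    (fun x y z => by simp only [Pi.add_apply, mul_add, Finset.sum_add_distrib]; ring)
    (fun c x y => by
      simp only [Pi.smul_apply, smul_eq_mul, mul_sub, Finset.mul_sum, mul_left_comm])

theorem lorentzForm_apply (x y : Fin d → Q) :
    lorentzForm d Q x y = x 0 * y 0 - ∑ i ∈ Finset.univ.erase (0 : Fin d), x i * y i := rfl

theorem lorentzForm_comm (x y : Fin d → Q) : lorentzForm d Q x y = lorentzForm d Q y x := by
  simp only [lorentzForm_apply, mul_comm]

theorem minkowski_one (x : Fin d → Q) : minkowski 1 x = lorentzForm d Q x x := by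
  simp only [lorentzForm_apply, minkowski, one_mul, pow_two]

theorem lorentzForm_add_self (x y : Fin d → Q) :
    lorentzForm d Q (x + y) (x + y) =
      lorentzForm d Q x x + 2 * lorentzForm d Q x y + lorentzForm d Q y y := by
  simp only [map_add, LinearMap.add_apply, lorentzForm_comm y x]; ring

theorem lorentzForm_sub_self (x y : Fin d → Q) :
    lorentzForm d Q (x - y) (x - y) =
      lorentzForm d Q x x - 2 * lorentzForm d Q x y + lorentzForm d Q y y := by
  simp only [map_sub, LinearMap.sub_apply, lorentzForm_comm y x]; ring

theorem lorentzForm_smul_self (t : Q) (x : Fin d → Q) :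
    lorentzForm d Q (t • x) (t • x) = t ^ 2 * lorentzForm d Q x x := by
  simp only [map_smul, LinearMap.smul_apply, smul_eq_mul]; ring

theorem lorentzForm_single_zero_zero :
    lorentzForm d Q (Pi.single 0 1) (Pi.single 0 1) = 1 := by
  rw [lorentzForm_apply, Finset.sum_eq_zero] <;> simp +contextual

theorem lorentzForm_single_zero_single {i : Fin d} (hi : i ≠ 0) :
    lorentzForm d Q (Pi.single 0 1) (Pi.single i 1) = 0 := by
  rw [lorentzForm_apply, Finset.sum_eq_zero]
  · simp [hi.symm]
  · simp +contextual [Pi.single_apply]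

theorem lorentzForm_single_single_zero {i : Fin d} (hi : i ≠ 0) :
    lorentzForm d Q (Pi.single i 1) (Pi.single 0 1) = 0 := by
  rw [lorentzForm_comm, lorentzForm_single_zero_single hi]

theorem lorentzForm_single_single_self {i : Fin d} (hi : i ≠ 0) :
    lorentzForm d Q (Pi.single i 1) (Pi.single i 1) = -1 := by
  rw [lorentzForm_apply, Finset.sum_eq_single i]
  · simp [hi.symm]
  · simp +contextual
  · simp [hi]

theorem lorentzForm_single_single_of_ne {i j : Fin d} (hi : i ≠ 0) (hij : i ≠ j) :
    lorentzForm d Q (Pi.single i 1) (Pi.single j 1) = 0 := by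
  rw [lorentzForm_apply, Finset.sum_eq_zero]
  · simp [Pi.single_apply, hi.symm]
  · intro l _
    by_cases h : l = i
    · subst h; simp [hij]
    · simp [h]

theorem single_eq_smul_single_one (i : Fin d) (s : Q) :
    (Pi.single i s : Fin d → Q) = s • Pi.single i 1 := by
  rw [← Pi.single_smul]; simp

theorem lorentzForm_lightVector {i : Fin d} (hi : i ≠ 0) (s e : Q) (he : e ^ 2 = 1) :
    lorentzForm d Q (s • (Pi.single 0 1 + e • Pi.single i 1))
      (s • (Pi.single 0 1 + e • Pi.single i 1)) = 0 := by
  rw [lorentzForm_smul_self, lorentzForm_add_self, lorentzForm_smul_self, map_smul,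
    lorentzForm_single_zero_zero, lorentzForm_single_zero_single hi,
    lorentzForm_single_single_self hi, he]
  simp

/-- Bijections preserving the relation of being connectible by a null line, in both
directions. -/
def PreservesNull (g : (Fin d → Q) ≃ (Fin d → Q)) : Prop :=
  ∀ x y, lorentzForm d Q (g x - g y) (g x - g y) = 0 ↔ lorentzForm d Q (x - y) (x - y) = 0

theorem PreservesNull.null_sub {g : (Fin d → Q) ≃ (Fin d → Q)} (hg : PreservesNull g)
    {n : Fin d → Q} (hn : lorentzForm d Q n n = 0) (a : Fin d → Q) :
    lorentzForm d Q (g (a + n) - g a) (g (a + n) - g a) = 0 := by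
  rw [hg, add_sub_cancel_left, hn]

theorem PreservesNull.sub_ne_zero {g : (Fin d → Q) ≃ (Fin d → Q)} {n : Fin d → Q}
    (h0 : n ≠ 0) (a : Fin d → Q) : g (a + n) - g a ≠ 0 := by
  intro h
  have := g.injective (_root_.sub_eq_zero.1 h)
  exact h0 (by simpa using this)

variable [LinearOrder Q] [IsStrictOrderedRing Q]

theorem eq_zero_of_lorentzForm_self_eq_zero {x : Fin d → Q} (hx : lorentzForm d Q x x = 0)
    (h0 : x 0 = 0) : x = 0 := by
  rw [lorentzForm_apply, h0, mul_zero, zero_sub, neg_eq_zero,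
    Finset.sum_eq_zero_iff_of_nonneg fun i _ => mul_self_nonneg (x i)] at hx
  funext i
  by_cases hi : i = 0
  · rw [hi, h0]; rfl
  · exact mul_self_eq_zero.1 (hx i (by simp [hi]))

/-- Orthogonal null vectors are proportional. -/
theorem exists_eq_smul_of_null {u v : Fin d → Q} (hu : lorentzForm d Q u u = 0)
    (hv : lorentzForm d Q v v = 0) (huv : lorentzForm d Q u v = 0) (hu0 : u ≠ 0) :
    ∃ t : Q, v = t • u := by
  have h0 : u 0 ≠ 0 := fun h => hu0 (eq_zero_of_lorentzForm_self_eq_zero hu h)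
  refine ⟨v 0 / u 0, sub_eq_zero.1 (eq_zero_of_lorentzForm_self_eq_zero ?_ ?_)⟩
  · rw [lorentzForm_sub_self, lorentzForm_smul_self, map_smul, lorentzForm_comm v u, hu, hv, huv]
    simp
  · simp [h0]

/-- A point lies in the null hyperplane tangent to a null line exactly if it is on the line or not
connectible to any point of it. -/
theorem lorentzForm_eq_zero_iff_connectible {x a b : Fin d → Q} (hab : a ≠ b)
    (hn : lorentzForm d Q (b - a) (b - a) = 0) :
    lorentzForm d Q (x - a) (b - a) = 0 ↔
      (lorentzForm d Q (x - a) (x - a) = 0 ∧ lorentzForm d Q (x - b) (x - b) = 0) ∨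
        ∀ z, lorentzForm d Q (z - a) (z - a) = 0 → lorentzForm d Q (z - b) (z - b) = 0 →
          lorentzForm d Q (z - x) (z - x) ≠ 0 := by
  have key : ∀ z : Fin d → Q, lorentzForm d Q (z - b) (z - b) =
      lorentzForm d Q (z - a) (z - a) - 2 * lorentzForm d Q (z - a) (b - a) := by
    intro z
    rw [← sub_sub_sub_cancel_right z b a, lorentzForm_sub_self, hn, add_zero]
  have line : ∀ t : Q, lorentzForm d Q (t • (b - a) - (x - a)) (t • (b - a) - (x - a)) =
      lorentzForm d Q (x - a) (x - a) - 2 * t * lorentzForm d Q (x - a) (b - a) := by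
    intro t
    rw [lorentzForm_sub_self, lorentzForm_smul_self, hn, map_smul, LinearMap.smul_apply,
      lorentzForm_comm (b - a), smul_eq_mul]
    ring
  constructor
  · intro h
    by_cases hx : lorentzForm d Q (x - a) (x - a) = 0
    · left
      rw [key, h, hx]; simp
    · right
      intro z hza hzb hzx
      rw [key, hza] at hzb
      obtain ⟨t, ht⟩ := exists_eq_smul_of_null hn hza
        (by rw [lorentzForm_comm]; simpa using hzb) (sub_ne_zero.2 hab.symm)
      rw [← sub_sub_sub_cancel_right z x a, ht, line, h] at hzx
      exact hx (by simpa using hzx)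
  · rintro (⟨h1, h2⟩ | h)
    · rw [key, h1] at h2
      simpa using h2
    · by_contra hne
      -- The parameter is the root of the affine function of `t` in `line`: the point where the null
      -- line meets the light cone of `x`.
      have hz := h (a + (lorentzForm d Q (x - a) (x - a) /
        (2 * lorentzForm d Q (x - a) (b - a))) • (b - a)) (by
          rw [add_sub_cancel_left, lorentzForm_smul_self, hn, mul_zero]) (by
          rw [key, add_sub_cancel_left, lorentzForm_smul_self, map_smul, LinearMap.smul_apply, hn]
          simp)
      rw [← sub_sub_sub_cancel_right _ x a, add_sub_cancel_left, line] at hz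
      apply hz
      field_simp
      ring

/-! ### Null lines, tangent hyperplanes and parallelism under null bijections -/

namespace PreservesNull

variable {g : (Fin d → Q) ≃ (Fin d → Q)}

/-- Three pairwise connectible points are collinear: two null vectors with null difference are
orthogonal, hence proportional. -/
theorem line (hg : PreservesNull g) {n : Fin d → Q} (hn : lorentzForm d Q n n = 0) (h0 : n ≠ 0)
    (a : Fin d → Q) (t : Q) : ∃ s : Q, g (a + t • n) - g a = s • (g (a + n) - g a) := by
  have h1 := hg.null_sub hn a
  have h2 : lorentzForm d Q (g (a + t • n) - g a) (g (a + t • n) - g a) = 0 :=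
    hg.null_sub (by rw [lorentzForm_smul_self, hn, mul_zero]) a
  have h3 : lorentzForm d Q (g (a + t • n) - g (a + n)) (g (a + t • n) - g (a + n)) = 0 := by
    rw [hg, add_sub_add_left_eq_sub, lorentzForm_sub_self, lorentzForm_smul_self, map_smul,
      LinearMap.smul_apply, hn]
    simp
  refine exists_eq_smul_of_null h1 h2 ?_ (sub_ne_zero h0 a)
  rw [← sub_sub_sub_cancel_right _ (g (a + n)) (g a), lorentzForm_sub_self, h1, h2] at h3
  rw [lorentzForm_comm]
  simpa using h3

theorem hyperplane (hg : PreservesNull g) {n : Fin d → Q} (hn : lorentzForm d Q n n = 0)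
    (h0 : n ≠ 0) (a x : Fin d → Q) :
    lorentzForm d Q (g x - g a) (g (a + n) - g a) = 0 ↔ lorentzForm d Q (x - a) n = 0 := by
  have hab : a ≠ a + n := by simpa using h0
  have h := lorentzForm_eq_zero_iff_connectible (x := x) hab (by simpa using hn)
  rw [add_sub_cancel_left] at h
  rw [h, lorentzForm_eq_zero_iff_connectible (g.injective.ne hab) (hg.null_sub hn a),
    g.surjective.forall]
  simp only [ne_eq, hg _ _]

/-- If the second line lies in the tangent hyperplane of the first, so do the images, and orthogonal
null directions are proportional. Otherwise the two tangent hyperplanes are disjoint, and so are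
their images; non-orthogonal image directions would make them meet. -/
theorem parallel (hg : PreservesNull g) {n : Fin d → Q} (hn : lorentzForm d Q n n = 0)
    (h0 : n ≠ 0) (a b : Fin d → Q) : ∃ s : Q, g (b + n) - g b = s • (g (a + n) - g a) := by
  refine exists_eq_smul_of_null (hg.null_sub hn a) (hg.null_sub hn b) ?_ (sub_ne_zero h0 a)
  by_cases hab : lorentzForm d Q (b - a) n = 0
  · have h1 := (hg.hyperplane hn h0 a b).2 hab
    have h2 := (hg.hyperplane hn h0 a (b + n)).2 (by
      rw [add_sub_right_comm, map_add, LinearMap.add_apply, hab, hn, add_zero])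
    rw [lorentzForm_comm, ← sub_sub_sub_cancel_right (g (b + n)) (g b) (g a), map_sub (lorentzForm d Q),
      LinearMap.sub_apply, h1, h2, sub_zero]
  · by_contra hne
    set u := g (a + n) - g a with hu
    set v := g (b + n) - g b with hv
    -- The point where the image of the first line meets the tangent hyperplane of the image of the
    -- second.
    set y := g a + (lorentzForm d Q (g b - g a) v / lorentzForm d Q u v) • u with hy
    have h1 := (hg.hyperplane hn h0 a (g.symm y)).1 (by
      rw [← hu, g.apply_symm_apply, hy, add_sub_cancel_left, map_smul, LinearMap.smul_apply,
        hg.null_sub hn a, smul_zero])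
    have h2 := (hg.hyperplane hn h0 b (g.symm y)).1 (by
      rw [← hv, g.apply_symm_apply, hy, add_sub_right_comm, map_add, LinearMap.add_apply, map_smul,
        LinearMap.smul_apply, smul_eq_mul, div_mul_cancel₀ _ hne, ← LinearMap.add_apply, ← map_add]
      simp)
    apply hab
    rw [← sub_sub_sub_cancel_left a b (g.symm y), map_sub, LinearMap.sub_apply, h1, h2, sub_zero]

/-- Opposite sides have parallel images, with ratios `s` and `t`. Closing the quadrilateral gives a
linear relation between two non-orthogonal null vectors; pairing it with one of them yields `s = 1`.
-/
theorem parallelogram (hg : PreservesNull g) {n p : Fin d → Q} (hn : lorentzForm d Q n n = 0)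
    (hp : lorentzForm d Q p p = 0) (hnp : lorentzForm d Q n p ≠ 0) (a : Fin d → Q) :
    g (a + p + n) - g (a + p) = g (a + n) - g a := by
  have hn0 : n ≠ 0 := by rintro rfl; simp at hnp
  have hp0 : p ≠ 0 := by rintro rfl; simp at hnp
  obtain ⟨s, hs⟩ := hg.parallel hn hn0 a (a + p)
  obtain ⟨t, ht⟩ := hg.parallel hp hp0 a (a + n)
  have hne : lorentzForm d Q (g (a + n) - g a) (g (a + p) - g a) ≠ 0 := by
    intro h
    have h1 := (hg.hyperplane hp hp0 a (a + n)).1 h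
    rw [add_sub_cancel_left] at h1
    exact hnp h1
  have h : (s - 1) • (g (a + n) - g a) = (t - 1) • (g (a + p) - g a) := by
    rw [sub_smul, sub_smul, ← hs, ← ht, one_smul, one_smul, add_right_comm a n p]
    abel
  have h2 := congrArg (fun w => lorentzForm d Q w (g (a + p) - g a)) h
  simp only [map_smul, LinearMap.smul_apply, hg.null_sub hp a, smul_eq_mul, mul_zero] at h2
  have : s = 1 := by
    rcases mul_eq_zero.1 h2 with h | h
    · exact _root_.sub_eq_zero.1 h
    · exact absurd h hne
  rw [hs, this, one_smul]

end PreservesNull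

/-! ### Additivity -/

/-- An additive subgroup containing all multiples of `e₀ ± eᵢ`, except possibly those of one
vector `e₀ + eᵢ` or `e₀ - eᵢ`, is everything. -/
theorem addSubgroup_eq_top_of_null_mem (S : AddSubgroup (Fin d → Q)) {e : Q} (he : e ^ 2 = 1)
    {i j : Fin d} (hij : i ≠ j) (hi : i ≠ 0) (hj : j ≠ 0)
    (h1 : ∀ s : Q, s • (Pi.single 0 1 - e • Pi.single i 1 : Fin d → Q) ∈ S)
    (h2 : ∀ l ≠ i, l ≠ 0 → ∀ s f : Q, f ^ 2 = 1 →
      s • (Pi.single 0 1 + f • Pi.single l 1 : Fin d → Q) ∈ S) : S = ⊤ := by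
  have h0 : ∀ s : Q, s • (Pi.single 0 1 : Fin d → Q) ∈ S := by
    intro s
    have := S.add_mem (h2 j hij.symm hj (s / 2) 1 (by norm_num))
      (h2 j hij.symm hj (s / 2) (-1) (by norm_num))
    convert this using 1
    module
  have hl : ∀ l, ∀ s : Q, s • (Pi.single l 1 : Fin d → Q) ∈ S := by
    intro l s
    by_cases hl0 : l = 0
    · rw [hl0]; exact h0 s
    by_cases hli : l = i
    · subst hli
      convert S.sub_mem (h0 (s * e)) (h1 (s * e)) using 1
      have : s = s * e * e := by rw [mul_assoc, ← pow_two, he, mul_one]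
      nth_rw 1 [this]
      module
    · convert S.sub_mem (h2 l hli hl0 s 1 (by norm_num)) (h0 s) using 1
      module
  rw [eq_top_iff]
  intro x _
  rw [← Finset.univ_sum_single x]
  refine S.sum_mem fun l _ => ?_
  rw [single_eq_smul_single_one]
  exact hl l _

theorem exists_ne_ne_zero (hd : 3 ≤ d) (i : Fin d) : ∃ j : Fin d, j ≠ i ∧ j ≠ 0 := by
  by_contra! h
  have h2 : (Finset.univ : Finset (Fin d)) ⊆ {i, 0} := by
    intro j _
    by_cases hj : j = i
    · simp [hj]
    · simp [h j hj]
  have := (Finset.card_le_card h2).trans Finset.card_le_two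
  simp at this
  omega

/-- The shifts that leave the increment along `n` unchanged form a subgroup. `parallelogram` puts
into it the light vectors not orthogonal to `n`; the direction of `n` itself is out of reach, which
is the exception allowed in `addSubgroup_eq_top_of_null_mem`. -/
theorem PreservesNull.add_light (hd : 3 ≤ d) {g : (Fin d → Q) ≃ (Fin d → Q)}
    (hg : PreservesNull g) {i : Fin d} (hi : i ≠ 0) (t e : Q) (he : e ^ 2 = 1)
    (a b : Fin d → Q) :
    g (a + b + t • (Pi.single 0 1 + e • Pi.single i 1)) - g (a + b) =
      g (a + t • (Pi.single 0 1 + e • Pi.single i 1)) - g a := by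
  obtain ⟨j, hji, hj⟩ := exists_ne_ne_zero hd i
  by_cases ht : t = 0
  · simp [ht]
  set n : Fin d → Q := t • (Pi.single 0 1 + e • Pi.single i 1) with hn
  have hnull : lorentzForm d Q n n = 0 := lorentzForm_lightVector hi t e he
  let S : AddSubgroup (Fin d → Q) :=
    { carrier := {w | ∀ a, g (a + w + n) - g (a + w) = g (a + n) - g a}
      zero_mem' := fun a => by simp
      add_mem' := fun {v w} hv hw a => by rw [← add_assoc, hw (a + v), hv a]
      neg_mem' := fun {v} hv a => by
        have := hv (a + -v)
        rw [neg_add_cancel_right] at this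
        exact this.symm }
  have hS : S = ⊤ := by
    refine addSubgroup_eq_top_of_null_mem S he hji.symm hi hj ?_ ?_
    · intro s
      by_cases hs : s = 0
      · rw [hs, zero_smul]; exact S.zero_mem
      refine fun a => hg.parallelogram hnull ?_ ?_ a
      · rw [sub_eq_add_neg, ← neg_smul]
        exact lorentzForm_lightVector hi s (-e) (by rw [neg_sq, he])
      · have : lorentzForm d Q n (s • (Pi.single 0 1 - e • Pi.single i 1)) = t * s * 2 := by
          simp only [hn, map_smul, map_add, map_sub, LinearMap.smul_apply, LinearMap.add_apply,
            smul_eq_mul, lorentzForm_single_single_zero hi,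
            lorentzForm_single_zero_zero, lorentzForm_single_zero_single hi,
            lorentzForm_single_single_self hi]
          linear_combination (t * s) * he
        rw [this]
        exact mul_ne_zero (mul_ne_zero ht hs) two_ne_zero
    · intro l hli hl s f hf
      by_cases hs : s = 0
      · rw [hs, zero_smul]; exact S.zero_mem
      refine fun a => hg.parallelogram hnull (lorentzForm_lightVector hl s f hf) ?_ a
      have : lorentzForm d Q n (s • (Pi.single 0 1 + f • Pi.single l 1)) = t * s := by
        simp only [hn, map_smul, map_add, LinearMap.smul_apply, LinearMap.add_apply,
          smul_eq_mul, lorentzForm_single_single_zero hi,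
          lorentzForm_single_zero_zero,
          lorentzForm_single_zero_single hl, lorentzForm_single_single_of_ne hi hli.symm]
        ring
      rw [this]
      exact mul_ne_zero ht hs
  exact (hS ▸ AddSubgroup.mem_top b : b ∈ S) a

theorem PreservesNull.map_add (hd : 3 ≤ d) {g : (Fin d → Q) ≃ (Fin d → Q)}
    (hg : PreservesNull g) (h0 : g 0 = 0) (a b : Fin d → Q) : g (a + b) = g a + g b := by
  obtain ⟨i, -, hi⟩ := exists_ne_ne_zero hd 0
  obtain ⟨j, hji, hj⟩ := exists_ne_ne_zero hd i
  let S : AddSubgroup (Fin d → Q) :=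
    { carrier := {w | ∀ a, g (a + w) = g a + g w}
      zero_mem' := fun a => by simp [h0]
      add_mem' := fun {v w} hv hw a => by rw [← add_assoc, hw (a + v), hv a, hw v, add_assoc]
      neg_mem' := fun {v} hv a => by
        have h1 := hv (a + -v)
        have h2 := hv (-v)
        rw [neg_add_cancel_right] at h1
        rw [neg_add_cancel, h0] at h2
        rw [h1, add_assoc, add_comm (g v), ← h2, add_zero] }
  have hS : S = ⊤ := by
    have hlight : ∀ l ≠ 0, ∀ s f : Q, f ^ 2 = 1 →
        s • (Pi.single 0 1 + f • Pi.single l 1 : Fin d → Q) ∈ S := by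
      intro l hl s f hf a
      have := hg.add_light hd hl s f hf 0 a
      rw [zero_add, zero_add, h0, sub_zero] at this
      rw [← this, add_sub_cancel]
    refine addSubgroup_eq_top_of_null_mem S (one_pow 2) hji.symm hi hj ?_ fun l _ => hlight l
    intro s
    rw [sub_eq_add_neg, ← neg_smul]
    exact hlight i hi s (-1) (by norm_num)
  exact (hS ▸ AddSubgroup.mem_top b : b ∈ S) a

/-! ### Multipliers on null lines and semilinearity -/

/-- Additive maps compatible with the conic `xy + xz + yz = 0` coincide and are multiplicative. -/
theorem eq_and_map_mul_of_conic {f₁ f₂ f₃ : Q →+ Q} (h₁ : f₁ 1 = 1) (h₂ : f₂ 1 = 1)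
    (h₃ : f₃ 1 = 1) (hi₁ : Function.Injective f₁) (hi₂ : Function.Injective f₂) {b₁₂ b₁₃ b₂₃ : Q} (hb : b₁₂ ≠ 0)
    (h : ∀ x y z : Q, x * y + x * z + y * z = 0 →
      b₁₂ * (f₁ x * f₂ y) + b₁₃ * (f₁ x * f₃ z) + b₂₃ * (f₂ y * f₃ z) = 0) :
    f₂ = f₁ ∧ f₃ = f₁ ∧ ∀ x y, f₁ (x * y) = f₁ x * f₁ y := by
  have two : ∀ (f : Q →+ Q) (t : Q), f (2 * t) = 2 * f t := fun f t => by
    rw [two_mul, map_add, two_mul]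
  -- `(2, 2, -1)` and `(2, -1, 2)` lie on the conic. At `t = 1` they force the three coefficients to
  -- be equal; for general `t` they identify the three maps.
  have A : ∀ t, b₁₂ * (2 * f₁ t * (2 * f₂ t)) + b₁₃ * (2 * f₁ t * -f₃ t) +
      b₂₃ * (2 * f₂ t * -f₃ t) = 0 := fun t => by
    simpa only [two, map_neg] using h (2 * t) (2 * t) (-t) (by ring)
  have A' : ∀ t, b₁₂ * (2 * f₁ t * -f₂ t) + b₁₃ * (2 * f₁ t * (2 * f₃ t)) +
      b₂₃ * (-f₂ t * (2 * f₃ t)) = 0 := fun t => by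
    simpa only [two, map_neg] using h (2 * t) (-t) (2 * t) (by ring)
  have e₁ := A 1
  have e₂ := A' 1
  rw [h₁, h₂, h₃] at e₁ e₂
  have hb₁₃ : b₁₃ = b₁₂ := by linear_combination (e₂ - e₁) / 6
  have hb₂₃ : b₂₃ = b₁₂ := by linear_combination (-2 * e₁ - e₂) / 6
  rw [hb₁₃, hb₂₃] at A A' h
  have ne : ∀ {f : Q →+ Q}, Function.Injective f → ∀ {t}, t ≠ 0 → f t ≠ 0 := fun hf t ht =>
    (map_ne_zero_iff _ hf).2 ht
  have E₂₃ : ∀ t, f₂ t = f₃ t := fun t => by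
    by_cases ht : t = 0
    · simp [ht]
    refine mul_left_cancel₀ (mul_ne_zero hb (ne hi₁ ht)) ?_
    linear_combination (A t - A' t) / 6
  have E₁₂ : ∀ t, f₂ t = f₁ t := fun t => by
    by_cases ht : t = 0
    · simp [ht]
    have := A t
    rw [← E₂₃] at this
    refine mul_left_cancel₀ (mul_ne_zero hb (ne hi₂ ht)) ?_
    linear_combination -this / 2
  refine ⟨AddMonoidHom.ext E₁₂, AddMonoidHom.ext fun t => by rw [← E₂₃, E₁₂], ?_⟩
  have sq : ∀ x, f₁ (x * x) = f₁ x * f₁ x := by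
    intro x
    -- This point of the conic has first two coordinates summing to `1`, so the relation reduces to
    -- compatibility with squaring; polarization then gives products.
    have := h x (1 - x) (-(x - x * x)) (by ring)
    rw [← E₂₃, E₁₂, E₁₂, map_neg, map_sub, map_sub, h₁] at this
    refine mul_left_cancel₀ hb ?_
    linear_combination this
  intro x y
  have := sq (x + y)
  rw [show (x + y) * (x + y) = x * x + (x * y + x * y) + y * y by ring, map_add, map_add, map_add,
    map_add, sq, sq] at this
  linear_combination this / 2

/-- The multiplier with which an additive null-preserving map acts on a null line. -/
theorem PreservesNull.exists_multiplier {g : (Fin d → Q) ≃ (Fin d → Q)} (hg : PreservesNull g)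
    (hadd : ∀ a b, g (a + b) = g a + g b) {n : Fin d → Q} (hn : lorentzForm d Q n n = 0)
    (h0 : n ≠ 0) : ∃ f : Q →+ Q, Function.Bijective f ∧ f 1 = 1 ∧ ∀ t, g (t • n) = f t • g n := by
  have hg0 : g 0 = 0 := by simpa using hadd 0 0
  have hgn : g n ≠ 0 := by rw [← hg0]; exact g.injective.ne h0
  have hl := hg.line hn h0 0
  simp only [zero_add, hg0, sub_zero] at hl
  choose f hf using hl
  refine ⟨AddMonoidHom.mk' f fun s t => ?_, ⟨fun s t hst => ?_, fun s => ?_⟩, ?_, hf⟩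
  · apply smul_left_injective Q hgn
    change f (s + t) • g n = (f s + f t) • g n
    rw [← hf, add_smul, add_smul, hadd, hf, hf]
  · have : f s • g n = f t • g n := congrArg (· • g n) hst
    rw [← hf, ← hf] at this
    exact smul_left_injective Q h0 (g.injective this)
  · have hgn' : lorentzForm d Q (g n) (g n) = 0 := by
      simpa [hg0] using hg.null_sub hn 0
    -- Surjectivity: the preimage of `s • g n` is connectible to both `0` and `n`, hence a multiple
    -- of `n`.
    have h1 := hg (g.symm (s • g n)) 0
    have h2 := hg (g.symm (s • g n)) n
    rw [g.apply_symm_apply] at h1 h2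
    rw [hg0, sub_zero, sub_zero, lorentzForm_smul_self, hgn'] at h1
    rw [lorentzForm_sub_self, lorentzForm_sub_self, lorentzForm_smul_self, map_smul,
      LinearMap.smul_apply, hgn', h1.1 (by simp), hn] at h2
    obtain ⟨t, ht⟩ := exists_eq_smul_of_null hn (h1.1 (by simp))
      (by rw [lorentzForm_comm]; simpa using h2) h0
    refine ⟨t, smul_left_injective Q hgn ?_⟩
    change f t • g n = s • g n
    rw [← hf, ← ht, g.apply_symm_apply]
  · apply smul_left_injective Q hgn
    change f 1 • g n = (1 : Q) • g n
    rw [← hf, one_smul, one_smul]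

/-- With equal pairwise products, `x • n₁ + y • n₂ + z • n₃` is null exactly on `xy + xz + yz = 0`.
Nullity of its image is the relation required by `eq_and_map_mul_of_conic`. -/
theorem PreservesNull.exists_ringEquiv_triple {g : (Fin d → Q) ≃ (Fin d → Q)}
    (hg : PreservesNull g) (hadd : ∀ a b, g (a + b) = g a + g b) {n₁ n₂ n₃ : Fin d → Q}
    (h₁ : lorentzForm d Q n₁ n₁ = 0) (h₂ : lorentzForm d Q n₂ n₂ = 0)
    (h₃ : lorentzForm d Q n₃ n₃ = 0) (h₁₂ : lorentzForm d Q n₁ n₂ ≠ 0)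
    (h₁₃ : lorentzForm d Q n₁ n₃ = lorentzForm d Q n₁ n₂)
    (h₂₃ : lorentzForm d Q n₂ n₃ = lorentzForm d Q n₁ n₂) :
    ∃ f : Q ≃+* Q, ∀ t, g (t • n₁) = f t • g n₁ ∧ g (t • n₂) = f t • g n₂ ∧
      g (t • n₃) = f t • g n₃ := by
  have hg0 : g 0 = 0 := by simpa using hadd 0 0
  have null : ∀ v, lorentzForm d Q (g v) (g v) = 0 ↔ lorentzForm d Q v v = 0 := fun v => by
    simpa [hg0] using hg v 0
  have hn₁ : n₁ ≠ 0 := by rintro rfl; simp at h₁₂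
  have hn₂ : n₂ ≠ 0 := by rintro rfl; simp at h₁₂
  have hn₃ : n₃ ≠ 0 := by rintro rfl; simp at h₁₃; exact h₁₂ h₁₃.symm
  obtain ⟨f₁, hb₁, ho₁, hf₁⟩ := hg.exists_multiplier hadd h₁ hn₁
  obtain ⟨f₂, hb₂, ho₂, hf₂⟩ := hg.exists_multiplier hadd h₂ hn₂
  obtain ⟨f₃, hb₃, ho₃, hf₃⟩ := hg.exists_multiplier hadd h₃ hn₃
  obtain ⟨e₂, e₃, hmul⟩ := eq_and_map_mul_of_conic ho₁ ho₂ ho₃ hb₁.1 hb₂.1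
    (b₁₂ := lorentzForm d Q (g n₁) (g n₂)) (b₁₃ := lorentzForm d Q (g n₁) (g n₃))
    (b₂₃ := lorentzForm d Q (g n₂) (g n₃)) (by
      intro h
      have := (null (n₁ + n₂)).1 (by
        rw [hadd, lorentzForm_add_self, h, (null n₁).2 h₁, (null n₂).2 h₂]; simp)
      rw [lorentzForm_add_self, h₁, h₂] at this
      exact h₁₂ (by simpa using this)) (by
      intro x y z hxyz
      have := (null (x • n₁ + y • n₂ + z • n₃)).2 (by
        simp only [_root_.map_add, map_smul, LinearMap.add_apply, LinearMap.smul_apply, smul_eq_mul,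
          lorentzForm_comm n₂ n₁, lorentzForm_comm n₃ n₁, lorentzForm_comm n₃ n₂, h₁, h₂, h₃, h₁₃,
          h₂₃]
        linear_combination 2 * lorentzForm d Q n₁ n₂ * hxyz)
      rw [hadd, hadd, hf₁, hf₂, hf₃] at this
      simp only [_root_.map_add, map_smul, LinearMap.add_apply, LinearMap.smul_apply, smul_eq_mul,
        lorentzForm_comm (g n₂) (g n₁), lorentzForm_comm (g n₃) (g n₁),
        lorentzForm_comm (g n₃) (g n₂), (null _).2 h₁, (null _).2 h₂, (null _).2 h₃] at this
      linear_combination this / 2)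
  rw [e₂] at hf₂
  rw [e₃] at hf₃
  exact ⟨RingEquiv.ofBijective
    { f₁ with map_one' := ho₁, map_mul' := hmul : Q →+* Q } hb₁,
    fun t => ⟨hf₁ t, hf₂ t, hf₃ t⟩⟩

/-- Bijections preserving null lines in both directions and fixing the origin are semilinear. -/
theorem PreservesNull.exists_semilinear (hd : 3 ≤ d) {g : (Fin d → Q) ≃ (Fin d → Q)}
    (hg : PreservesNull g) (h0 : g 0 = 0) :
    ∃ f : Q ≃+* Q, ∀ (t : Q) (v : Fin d → Q), g (t • v) = f t • g v := by
  have hadd := hg.map_add hd h0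
  let G : (Fin d → Q) →+ (Fin d → Q) := AddMonoidHom.mk' g hadd
  obtain ⟨i, -, hi⟩ := exists_ne_ne_zero hd 0
  obtain ⟨j, hji, hj⟩ := exists_ne_ne_zero hd i
  have two_smul_cancel : ∀ u v : Fin d → Q, g (u + u) = v + v → g u = v := fun u v h => by
    rw [hadd, ← two_smul Q, ← two_smul Q v] at h
    exact smul_right_injective _ (two_ne_zero (α := Q)) h
  have key : ∀ l, l ≠ i → l ≠ 0 → ∃ f : Q ≃+* Q, ∀ t : Q,
      g (t • Pi.single 0 1) = f t • g (Pi.single 0 1) ∧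
      g (t • Pi.single i 1) = f t • g (Pi.single i 1) ∧
      g (t • Pi.single l 1) = f t • g (Pi.single l 1) := by
    intro l hli hl
    -- The triple is `e₀ + eᵢ`, `e₀ - eᵢ`, `2(e₀ + eₗ)`; the factor `2` makes all pairwise products
    -- equal to `2`.
    obtain ⟨f, hf⟩ := hg.exists_ringEquiv_triple hadd
      (lorentzForm_lightVector hi 1 1 (one_pow 2))
      (lorentzForm_lightVector hi 1 (-1) (by norm_num))
      (lorentzForm_lightVector hl 2 1 (one_pow 2))
      (by simp [lorentzForm_single_single_zero hi,
        lorentzForm_single_zero_zero, lorentzForm_single_zero_single hi,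
        lorentzForm_single_single_self hi])
      (by simp [lorentzForm_single_single_zero hi,
        lorentzForm_single_zero_zero, lorentzForm_single_zero_single hi,
        lorentzForm_single_single_self hi, lorentzForm_single_zero_single hl,
        lorentzForm_single_single_of_ne hi hli.symm]; norm_num)
      (by simp [lorentzForm_single_single_zero hi,
        lorentzForm_single_zero_zero, lorentzForm_single_zero_single hi,
        lorentzForm_single_single_self hi, lorentzForm_single_zero_single hl,
        lorentzForm_single_single_of_ne hi hli.symm]; norm_num)
    refine ⟨f, fun t => ?_⟩
    obtain ⟨h1, h2, h3⟩ := hf t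
    have hneg : ∀ u, g (-u) = -g u := map_neg G
    simp only [one_smul, neg_smul, two_smul, smul_add, smul_neg, hadd, hneg] at h1 h2 h3
    have a0 : g (t • Pi.single 0 1) = f t • g (Pi.single 0 1) := by
      apply two_smul_cancel
      rw [hadd]
      linear_combination (exp := 1) h1 + h2
    refine ⟨a0, ?_, ?_⟩
    · linear_combination (exp := 1) h1 - a0
    · apply two_smul_cancel
      rw [hadd]
      linear_combination (exp := 1) h3 - 2 * a0
  obtain ⟨f, hf⟩ := key j hji hj
  have hne : g (Pi.single 0 1) ≠ 0 := by
    rw [← h0]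
    exact g.injective.ne (by simp)
  have basis : ∀ l (t : Q), g (t • Pi.single l 1) = f t • g (Pi.single l 1) := by
    intro l t
    by_cases hl0 : l = 0
    · rw [hl0]; exact (hf t).1
    by_cases hli : l = i
    · rw [hli]; exact (hf t).2.1
    obtain ⟨f', hf'⟩ := key l hli hl0
    -- All triples share `e₀`, so their automorphisms agree.
    have : f' t = f t := smul_left_injective Q hne ((hf' t).1.symm.trans (hf t).1)
    rw [← this]
    exact (hf' t).2.2
  refine ⟨f, fun t v => ?_⟩
  have hsum : ∀ w, g w = ∑ l, f (w l) • g (Pi.single l 1) := fun w => by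
    conv_lhs => rw [← Finset.univ_sum_single w]
    rw [show g (∑ l, Pi.single l (w l)) = ∑ l, g (Pi.single l (w l)) from map_sum G _ _]
    refine Finset.sum_congr rfl fun l _ => ?_
    rw [single_eq_smul_single_one, basis]
  rw [hsum, hsum v, Finset.smul_sum]
  refine Finset.sum_congr rfl fun l _ => ?_
  rw [Pi.smul_apply, smul_eq_mul, map_mul, mul_smul]

/-! ### From null cone to form, and the decomposition -/

/-- Linear bijections preserving null vectors in both directions are almost Lorentz
transformations. -/
theorem isAlmostLorentz_of_null {A : (Fin d → Q) ≃ₗ[Q] (Fin d → Q)}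
    (hA : ∀ x, lorentzForm d Q (A x) (A x) = 0 ↔ lorentzForm d Q x x = 0) :
    IsAlmostLorentz A := by
  let C : LinearMap.BilinForm Q (Fin d → Q) := (lorentzForm d Q).compl₁₂ A.toLinearMap A.toLinearMap
  have hC : ∀ x y, C x y = lorentzForm d Q (A x) (A y) := fun _ _ => rfl
  have hCc : ∀ x y, C x y = C y x := fun x y => lorentzForm_comm _ _
  set e : Fin d → Fin d → Q := fun i => Pi.single i 1 with he
  set l := C (e 0) (e 0) with hl
  have light : ∀ i ≠ 0, ∀ f : Q, f ^ 2 = 1 → C (e 0 + f • e i) (e 0 + f • e i) = 0 := by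
    intro i hi f hf
    have := lorentzForm_lightVector hi 1 f hf
    rw [one_smul] at this
    exact (hA _).2 this
  have h0i : ∀ i ≠ 0, C (e 0) (e i) = 0 ∧ C (e i) (e i) = -l := by
    intro i hi
    have h1 := light i hi 1 (by norm_num)
    have h2 := light i hi (-1) (by norm_num)
    simp only [map_add, map_smul, LinearMap.add_apply, LinearMap.smul_apply, smul_eq_mul,
      hCc (e i) (e 0), ← hl] at h1 h2
    exact ⟨by linear_combination (h1 - h2) / 4, by linear_combination (h1 + h2) / 2⟩
  have hij : ∀ i ≠ 0, ∀ j ≠ 0, i ≠ j → C (e i) (e j) = 0 := by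
    intro i hi j hj hne
    -- The Pythagorean triple `3, 4, 5` gives a null vector involving two spatial axes without
    -- taking a square root.
    have h1 : C ((5 : Q) • e 0 + (3 : Q) • e i + (4 : Q) • e j)
        ((5 : Q) • e 0 + (3 : Q) • e i + (4 : Q) • e j) = 0 := by
      refine (hA _).2 ?_
      simp only [map_add, map_smul, LinearMap.add_apply, LinearMap.smul_apply, smul_eq_mul, he,
        lorentzForm_single_single_zero hi, lorentzForm_single_single_zero hj,
        lorentzForm_single_single_of_ne hj hne.symm,
        lorentzForm_single_zero_zero, lorentzForm_single_zero_single hi,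
        lorentzForm_single_zero_single hj, lorentzForm_single_single_self hi,
        lorentzForm_single_single_self hj, lorentzForm_single_single_of_ne hi hne]
      norm_num
    simp only [map_add, map_smul, LinearMap.add_apply, LinearMap.smul_apply, smul_eq_mul,
      hCc (e i) (e 0), hCc (e j) (e 0), hCc (e j) (e i), ← hl, h0i i hi, h0i j hj] at h1
    linear_combination h1 / 24
  have hCB : C = l • lorentzForm d Q := by
    refine LinearMap.BilinForm.ext_basis (Pi.basisFun Q (Fin d)) fun i j => ?_
    simp only [Pi.basisFun_apply, LinearMap.smul_apply, smul_eq_mul]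
    change C (e i) (e j) = _
    by_cases hi : i = 0 <;> by_cases hj : j = 0
    · subst hi hj
      rw [lorentzForm_single_zero_zero, mul_one]
    · subst hi
      rw [lorentzForm_single_zero_single hj, mul_zero, (h0i j hj).1]
    · subst hj
      rw [lorentzForm_comm, lorentzForm_single_zero_single hi, mul_zero, hCc, (h0i i hi).1]
    · by_cases hne : i = j
      · subst hne
        rw [lorentzForm_single_single_self hi, (h0i i hi).2, mul_neg, mul_one]
      · rw [lorentzForm_single_single_of_ne hi hne, hij i hi j hj hne, mul_zero]
  refine ⟨l, fun h => ?_, fun x => ?_⟩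
  · have := (hA (e 0)).1 (by rw [← hC, ← hl, h])
    rw [he, lorentzForm_single_zero_zero] at this
    exact one_ne_zero this
  · rw [minkowski_one, minkowski_one, ← hC, hCB]
    rfl

theorem lorentzForm_autInduced (f : Q ≃+* Q) (x : Fin d → Q) :
    lorentzForm d Q (autInduced f x) (autInduced f x) = f (lorentzForm d Q x x) := by
  simp [lorentzForm_apply, autInduced, map_sum]

/-- An Alexandrov–Zeeman theorem over ordered fields: bijections preserving null lines in both
directions are almost Lorentz transformations followed by a map induced by a field automorphism and
a translation. -/
theorem PreservesNull.exists_decomposition (hd : 3 ≤ d) {g : (Fin d → Q) ≃ (Fin d → Q)}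
    (hg : PreservesNull g) :
    ∃ (A : (Fin d → Q) ≃ₗ[Q] (Fin d → Q)) (f : Q ≃+* Q) (b : Fin d → Q),
      IsAlmostLorentz A ∧ ∀ x, g x = translation b (autInduced f (A x)) := by
  let h : (Fin d → Q) ≃ (Fin d → Q) := g.trans (Equiv.subRight (g 0))
  have hh : ∀ x, h x = g x - g 0 := fun _ => rfl
  have hN : PreservesNull h := fun x y => by
    rw [hh, hh, sub_sub_sub_cancel_right]; exact hg x y
  have h0 : h 0 = 0 := by rw [hh, sub_self]
  obtain ⟨f, hf⟩ := hN.exists_semilinear hd h0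
  -- Undoing the automorphism coordinatewise turns the semilinear `h` into a linear map.
  let A : (Fin d → Q) ≃ₗ[Q] (Fin d → Q) :=
    { h.trans (Equiv.piCongrRight fun _ => f.symm.toEquiv) with
      map_add' := fun x y => by
        funext i
        change f.symm (h (x + y) i) = f.symm (h x i) + f.symm (h y i)
        rw [hN.map_add hd h0, Pi.add_apply, _root_.map_add]
      map_smul' := fun t x => by
        funext i
        change f.symm (h (t • x) i) = t * f.symm (h x i)
        rw [hf, Pi.smul_apply, smul_eq_mul, map_mul, f.symm_apply_apply] }
  have hA : ∀ x, autInduced f (A x) = h x := fun x => by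
    funext i
    exact f.apply_symm_apply (h x i)
  refine ⟨A, f, g 0, isAlmostLorentz_of_null fun x => ?_, fun x => ?_⟩
  · have := hN x 0
    rw [h0, sub_zero, sub_zero] at this
    rw [← this, ← hA, lorentzForm_autInduced, map_eq_zero_iff f f.injective]
  · rw [hA, hh, translation, sub_add_cancel]

end NullGeometry

/-! ### Worldview transformations as null bijections -/

section Worldview

variable {d : ℕ} [NeZero d] {Q : Type*} [Field Q]

/-- Rescaling of the spatial coordinates as a permutation. -/
def spaceRescaleEquiv {c : Q} (hc : c ≠ 0) : (Fin d → Q) ≃ (Fin d → Q) where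
  toFun := spaceRescale c
  invFun := spaceRescale c⁻¹
  left_inv x := by funext i; by_cases hi : i = 0 <;> simp [spaceRescale, hi, hc]
  right_inv x := by funext i; by_cases hi : i = 0 <;> simp [spaceRescale, hi, hc]

/-- Rescaling of the time coordinate as a permutation. -/
def timeRescaleEquiv {c : Q} (hc : c ≠ 0) : (Fin d → Q) ≃ (Fin d → Q) where
  toFun := timeRescale c
  invFun := timeRescale c⁻¹
  left_inv x := by funext i; by_cases hi : i = 0 <;> simp [timeRescale, hi, hc]
  right_inv x := by funext i; by_cases hi : i = 0 <;> simp [timeRescale, hi, hc]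

theorem lorentzForm_timeRescale (c : Q) (x y : Fin d → Q) :
    lorentzForm d Q (timeRescale c x - timeRescale c y) (timeRescale c x - timeRescale c y) = 0 ↔
      space2 x y = c ^ 2 * time x y ^ 2 := by
  have : ∑ i ∈ Finset.univ.erase (0 : Fin d), (timeRescale c x - timeRescale c y) i *
      (timeRescale c x - timeRescale c y) i = space2 x y :=
    Finset.sum_congr rfl fun i hi => by
      simp [timeRescale, (Finset.mem_erase.1 hi).1, pow_two]
  rw [lorentzForm_apply, this, sub_eq_zero, eq_comm]
  simp only [Pi.sub_apply, timeRescale, if_true, time]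
  rw [show (c * x 0 - c * y 0) * (c * x 0 - c * y 0) = c ^ 2 * (x 0 - y 0) ^ 2 by ring]

theorem space2_spaceRescale_iff {c : Q} (hc : c ≠ 0) (x y : Fin d → Q) :
    space2 (spaceRescale c x) (spaceRescale c y) =
        c ^ 2 * time (spaceRescale c x) (spaceRescale c y) ^ 2 ↔
      lorentzForm d Q (x - y) (x - y) = 0 := by
  have : space2 (spaceRescale c x) (spaceRescale c y) = c ^ 2 *
      ∑ i ∈ Finset.univ.erase (0 : Fin d), (x - y) i * (x - y) i := by
    rw [Finset.mul_sum]
    refine Finset.sum_congr rfl fun i hi => ?_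
    simp only [spaceRescale, (Finset.mem_erase.1 hi).1, if_false, Pi.sub_apply]
    ring
  rw [this, lorentzForm_apply, sub_eq_zero, mul_right_inj' (pow_ne_zero 2 hc), eq_comm]
  simp [spaceRescale, time, pow_two]

variable [LinearOrder Q] [IsStrictOrderedRing Q] {B : Type*} {M : SpacetimeModel d B Q}

/-- `IsLightSpeed` supplies only one implication; uniqueness of the speed identifies `c` with the
constant of `AxPh`, which supplies both. -/
theorem IsLightSpeed.connectible_iff (hd : 2 ≤ d) (hPh : M.AxPh) {m : B} (hm : m ∈ M.IOb) {c : Q}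
    (hc : M.IsLightSpeed m c) (x y : Fin d → Q) :
    (∃ p ∈ M.Ph, M.W m p x ∧ M.W m p y) ↔ space2 x y = c ^ 2 * time x y ^ 2 := by
  obtain ⟨v, hv, h⟩ := hPh m hm
  have : v = c := (M.existsUnique_isLightSpeed hd hPh hm).unique ⟨hv, fun x y => (h x y).1⟩ hc
  rw [← this]
  exact h x y

/-- A point is determined by the set of points connectible to it. -/
theorem eq_of_connectible_iff (hd : 2 ≤ d) {x y : Fin d → Q}
    (h : ∀ z, lorentzForm d Q (z - x) (z - x) = 0 ↔ lorentzForm d Q (z - y) (z - y) = 0) :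
    x = y := by
  set w := x - y with hw
  have hi : (⟨1, hd⟩ : Fin d) ≠ 0 := by simp [Fin.ext_iff]
  have hww : lorentzForm d Q w w = 0 := (h x).1 (by simp)
  -- Testing with `x + (e₀ ± e₁)` makes the null vector `w` orthogonal to both light vectors, hence
  -- to `e₀`; its time component vanishes and so does `w`.
  have horth : ∀ f : Q, f ^ 2 = 1 →
      lorentzForm d Q w (Pi.single 0 1 + f • Pi.single ⟨1, hd⟩ 1) = 0 := by
    intro f hf
    have hn := lorentzForm_lightVector hi 1 f hf
    rw [one_smul] at hn
    have := (h (x + (Pi.single 0 1 + f • Pi.single ⟨1, hd⟩ 1))).1 (by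
      rw [add_sub_cancel_left, hn])
    rw [add_sub_right_comm, ← hw, lorentzForm_add_self, hww, hn] at this
    simpa using this
  have h1 := horth 1 (by norm_num)
  have h2 := horth (-1) (by norm_num)
  rw [map_add, map_smul, smul_eq_mul] at h1 h2
  have h3 : lorentzForm d Q w (Pi.single 0 1) = 0 := by linear_combination (h1 + h2) / 2
  have h4 : lorentzForm d Q w (Pi.single 0 1) = w 0 := by
    rw [lorentzForm_apply, Finset.sum_eq_zero] <;> simp +contextual
  exact sub_eq_zero.1 (eq_zero_of_lorentzForm_self_eq_zero hww (h4.symm.trans h3))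

theorem ev_nonempty (hPh : M.AxPh) {m : B} (hm : m ∈ M.IOb) (x : Fin d → Q) :
    (M.ev m x).Nonempty := by
  obtain ⟨c, -, h⟩ := hPh m hm
  obtain ⟨p, -, hp, -⟩ := (h x x).2 (by simp [space2, time])
  exact ⟨p, hp⟩

/-- Equal events contain the same photons, so the two points are light-connected to the same points.
-/
theorem ev_injective (hd : 2 ≤ d) (hPh : M.AxPh) {m : B} (hm : m ∈ M.IOb) :
    Function.Injective (M.ev m) := by
  obtain ⟨c, hc, h⟩ := hPh m hm
  intro x y hxy
  have hW : ∀ p, M.W m p x ↔ M.W m p y := fun p => Set.ext_iff.1 hxy p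
  refine (timeRescaleEquiv hc.ne').injective (eq_of_connectible_iff hd fun z => ?_)
  obtain ⟨z, rfl⟩ := (timeRescaleEquiv hc.ne').surjective z
  change lorentzForm d Q (timeRescale c z - timeRescale c x)
      (timeRescale c z - timeRescale c x) = 0 ↔
    lorentzForm d Q (timeRescale c z - timeRescale c y)
      (timeRescale c z - timeRescale c y) = 0
  rw [lorentzForm_timeRescale, lorentzForm_timeRescale, ← h, ← h]
  simp only [hW]

/-- Worldview transformations between inertial observers are bijections matching up light
signals. -/
theorem exists_equiv_worldview (hd : 2 ≤ d) (hEv : M.AxEv) (hPh : M.AxPh) {m k : B}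
    (hm : m ∈ M.IOb) (hk : k ∈ M.IOb) :
    ∃ F : (Fin d → Q) ≃ (Fin d → Q), M.worldview m k = Function.graph F ∧
      ∀ p x, M.W k p (F x) ↔ M.W m p x := by
  choose F hF using hEv m hm k hk
  choose G hG using hEv k hk m hm
  refine ⟨⟨F, G, fun x => ev_injective hd hPh hm ?_, fun y => ev_injective hd hPh hk ?_⟩, ?_,
    fun p x => (Set.ext_iff.1 (hF x) p).symm⟩
  · rw [← hG, ← hF]
  · rw [← hF, ← hG]
  · ext ⟨x, y⟩
    change _ ∧ _ ↔ F x = y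
    constructor
    · rintro ⟨h, -⟩
      exact ev_injective hd hPh hk ((hF x).symm.trans h)
    · rintro rfl
      exact ⟨hF x, ev_nonempty hPh hm x⟩

end Worldview

end SpacetimeModel

/-! ### Conjugation by the two rescalings -/

theorem theorem7p8 {d : ℕ} [NeZero d] (hd : 3 ≤ d) {B Q : Type*}
    [Field Q] [LinearOrder Q] [IsStrictOrderedRing Q]
    (M : SpacetimeModel d B Q) (hEv : M.AxEv) (hPh : M.AxPh)
    (m k : B) (hm : m ∈ M.IOb) (hk : k ∈ M.IOb)
    (cm ck : Q) (hcm : M.IsLightSpeed m cm) (hck : M.IsLightSpeed k ck) :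
    (∃ (A : (Fin d → Q) ≃ₗ[Q] (Fin d → Q)) (α : Q ≃+* Q) (b : Fin d → Q),
      SpacetimeModel.IsAlmostLorentz A ∧
      M.worldview m k =
        (Function.graph (SpacetimeModel.spaceRescale cm)).inv ○ Function.graph A ○
          Function.graph (SpacetimeModel.autInduced α) ○
          Function.graph (SpacetimeModel.translation b) ○
          Function.graph (SpacetimeModel.spaceRescale ck)) ∧
    (∃ (A : (Fin d → Q) ≃ₗ[Q] (Fin d → Q)) (α : Q ≃+* Q) (b : Fin d → Q),
      SpacetimeModel.IsAlmostLorentz A ∧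
      M.worldview m k =
        Function.graph (SpacetimeModel.timeRescale cm) ○ Function.graph A ○
          Function.graph (SpacetimeModel.autInduced α) ○
          Function.graph (SpacetimeModel.translation b) ○
          (Function.graph (SpacetimeModel.timeRescale ck)).inv) := by
  have hd2 : 2 ≤ d := by omega
  obtain ⟨F, hF, hW⟩ := SpacetimeModel.exists_equiv_worldview hd2 hEv hPh hm hk
  have hlight : ∀ x y, SpacetimeModel.space2 (F x) (F y) =
      ck ^ 2 * SpacetimeModel.time (F x) (F y) ^ 2 ↔
        SpacetimeModel.space2 x y = cm ^ 2 * SpacetimeModel.time x y ^ 2 := by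
    intro x y
    rw [← hcm.connectible_iff hd2 hPh hm, ← hck.connectible_iff hd2 hPh hk]
    simp only [hW]
  rw [hF]
  constructor
  · let Sm := SpacetimeModel.spaceRescaleEquiv (d := d) hcm.1.ne'
    let Sk := SpacetimeModel.spaceRescaleEquiv (d := d) hck.1.ne'
    -- `spaceRescale c` carries null lines to lines of speed `c`, so it is applied before `F` and
    -- inverted after; `timeRescale c` works the opposite way in the second half.
    have hg : SpacetimeModel.PreservesNull ((Sm.trans F).trans Sk.symm) := by
      intro x y
      rw [← SpacetimeModel.space2_spaceRescale_iff hck.1.ne',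
        ← SpacetimeModel.space2_spaceRescale_iff hcm.1.ne', ← hlight]
      change SpacetimeModel.space2 (Sk (Sk.symm (F (Sm x)))) (Sk (Sk.symm (F (Sm y)))) =
        ck ^ 2 * SpacetimeModel.time (Sk (Sk.symm (F (Sm x)))) (Sk (Sk.symm (F (Sm y)))) ^ 2 ↔ _
      rw [Sk.apply_symm_apply, Sk.apply_symm_apply]
      rfl
    obtain ⟨A, α, b, hA, h⟩ := hg.exists_decomposition hd
    refine ⟨A, α, b, hA, ?_⟩
    have h' : ∀ x, F (Sm x) = Sk (SpacetimeModel.translation b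
        (SpacetimeModel.autInduced α (A x))) := fun x => by
      rw [← h]; simp
    ext ⟨x, y⟩
    change F x = y ↔ ∃ u, (∃ v, (∃ w, (∃ z, Sm z = x ∧ A z = w) ∧
      SpacetimeModel.autInduced α w = v) ∧ SpacetimeModel.translation b v = u) ∧ Sk u = y
    constructor
    · rintro rfl
      exact ⟨_, ⟨_, ⟨_, ⟨Sm.symm x, Sm.apply_symm_apply x, rfl⟩, rfl⟩, rfl⟩, by
        rw [← h', Sm.apply_symm_apply]⟩
    · rintro ⟨_, ⟨_, ⟨_, ⟨z, rfl, rfl⟩, rfl⟩, rfl⟩, rfl⟩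
      exact h' z
  · let Tm := SpacetimeModel.timeRescaleEquiv (d := d) hcm.1.ne'
    let Tk := SpacetimeModel.timeRescaleEquiv (d := d) hck.1.ne'
    have hg : SpacetimeModel.PreservesNull ((Tm.symm.trans F).trans Tk) := by
      intro x y
      obtain ⟨x, rfl⟩ := Tm.surjective x
      obtain ⟨y, rfl⟩ := Tm.surjective y
      simp only [Equiv.trans_apply, Equiv.symm_apply_apply]
      exact ((SpacetimeModel.lorentzForm_timeRescale ck _ _).trans (hlight x y)).trans
        (SpacetimeModel.lorentzForm_timeRescale cm x y).symm
    obtain ⟨A, α, b, hA, h⟩ := hg.exists_decomposition hd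
    refine ⟨A, α, b, hA, ?_⟩
    have h' : ∀ x, Tk (F x) = SpacetimeModel.translation b
        (SpacetimeModel.autInduced α (A (Tm x))) := fun x => by
      rw [← h]; simp
    ext ⟨x, y⟩
    change F x = y ↔ ∃ u, (∃ v, (∃ w, (∃ z, Tm x = z ∧ A z = w) ∧
      SpacetimeModel.autInduced α w = v) ∧ SpacetimeModel.translation b v = u) ∧ Tk y = u
    constructor
    · rintro rfl
      exact ⟨_, ⟨_, ⟨_, ⟨_, rfl, rfl⟩, rfl⟩, rfl⟩, h' x⟩
    · rintro ⟨_, ⟨_, ⟨_, ⟨_, rfl, rfl⟩, rfl⟩, rfl⟩, hy⟩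
      exact Tk.injective ((h' x).trans hy.symm)
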